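/- Let $(M,g)$ be a connected, complete, $d$-dimensional Riemannian manifold (smooth, without boundary) with Riemannian distance $\mathrm d_M$, and let $B_M(x,r)$ denote the open ball of radius $r$ around $x$. Let $\mu$ be a Borel measure on $M$ that is finite on bounded sets, and assume that there are constants $r_0>0$ and $b_0>0$ such that $\mu(B_M(x,r_0))\ge b_0$ for every $x\in M$. Let $\eta$ be a Poisson point process on $M$ with intensity measure $\mu$, that is, a random locally finite configuration of points such that the number of points in each Borel set $A$ is Poisson distributed with parameter $\mu(A)$ and the numbers of points in finitely many pairwise disjoint Borel sets are independent (if $\mu$ has atoms, points are counted with multiplicity). For a point $x$ of $\eta$, its Voronoi cell is $$C(x;\eta)=\{y\in M:\ \mathrm d_M(y,x)\le \mathrm d_M(y,\eta)\},$$ where $\mathrm d_M(y,\eta)$ is the distance from $y$ to the set of points of $\eta$. Then, almost surely, for every point $x$ of $\eta$ the cell $C(x;\eta)$ is compact. -/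

import Mathlib

open MeasureTheory ProbabilityTheory
open scoped Manifold Bundle ENNReal

/-- A locally finite point configuration on `M`, viewed as a counting measure: a countable sum of
Dirac masses that gives finite mass to every bounded set. -/
structure IsPointConfiguration {M : Type*} [MetricSpace M] [MeasurableSpace M]
    (ν : Measure M) : Prop where
  eq_sum_dirac : ∃ (ι : Type) (_ : Countable ι) (p : ι → M),
    ν = Measure.sum fun i => Measure.dirac (p i)
  lt_top_of_isBounded : ∀ B : Set M, Bornology.IsBounded B → ν B < ∞

/-- The set of points (atoms) of a point configuration. -/
def pointSet {M : Type*} [MeasurableSpace M] (ν : Measure M) : Set M :=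
  {x | ν {x} ≠ 0}

/-- The Poisson distribution on `ℝ≥0∞` with parameter `r ∈ [0, ∞]`; for `r = ∞` it is the Dirac
mass at `∞`. -/
noncomputable def poissonLaw (r : ℝ≥0∞) : Measure ℝ≥0∞ :=
  open Classical in
  if r = ∞ then Measure.dirac ∞
  else (poissonMeasure r.toNNReal).map (fun n : ℕ => (n : ℝ≥0∞))

/-- `η` is a Poisson point process on `M` with intensity measure `μ`: a random locally finite point
configuration such that the number of points in a measurable set `A` is Poisson distributed with
parameter `μ A`, and the numbers of points in finitely many pairwise disjoint measurable sets are
independent. -/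
structure IsPoissonProcess {Ω M : Type*} [MeasurableSpace Ω] [MetricSpace M] [MeasurableSpace M]
    (η : Ω → Measure M) (μ : Measure M) (P : Measure Ω) : Prop where
  measurable : Measurable η
  isPointConfiguration : ∀ ω, IsPointConfiguration (η ω)
  hasLaw : ∀ A : Set M, MeasurableSet A → HasLaw (fun ω => η ω A) (poissonLaw (μ A)) P
  iIndepFun : ∀ (n : ℕ) (A : Fin n → Set M), (∀ i, MeasurableSet (A i)) →
    Pairwise (fun i j => Disjoint (A i) (A j)) → iIndepFun (fun i ω => η ω (A i)) P

/-- The Voronoi cell `{y | d(y, x) ≤ d(y, S)}` of `x` with respect to the set `S`. -/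
def voronoiCell {M : Type*} [MetricSpace M] (x : M) (S : Set M) : Set M :=
  {y | edist y x ≤ Metric.infEDist y S}

open Metric Set

/-! A far point `y` of the cell of `x` has no process point closer than `x`, so for `o` within
distance 1 of `x` the ball about `y` of radius `dist o y - 1` is empty. It suffices to exclude such
balls far from `o`.

Completeness makes the space proper and geodesic (`ProperSpace.of_exists_dist_le_add`,
`exists_dist_eq_dist_eq_sub`). Put finite nets on spheres about `o` whose radii grow by the factor
3/2, with disjoint balls around the net points that are each empty with probability at most 1/2.
Follow a geodesic from `o` to `y` through these spheres. At each step the large empty ball swallows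
the small balls of all net points that could come next.

Volume growth is not controlled, so a net point may have any number `c` of successors. Choosing
among them costs a factor `c`, but emptiness of all their balls gains `2⁻¹ ^ c`, and `c * 2⁻¹ ^ c ≤
2⁻¹`. Hence `n` generations survive with probability at most `2⁻¹ ^ n`
(`measure_biInter_inter_survivalEvent_le`). -/

/-! ### Geodesics, properness and separated nets. -/

/-- In a Riemannian manifold there are points at any prescribed distance from `x` which are almost
on a shortest path from `x` to `y`. -/
theorem IsRiemannianManifold.exists_dist_eq_dist_le_add {E H M : Type*} [NormedAddCommGroup E]
    [NormedSpace ℝ E] [TopologicalSpace H] (I : ModelWithCorners ℝ E H) [MetricSpace M]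
    [ChartedSpace H M] [IsManifold I 1 M] [Bundle.RiemannianBundle (fun x : M => TangentSpace I x)]
    [IsRiemannianManifold I M] {x y : M} {s δ : ℝ} (hs : 0 ≤ s) (hsy : s ≤ dist x y) (hδ : 0 < δ) :
    ∃ z, dist x z = s ∧ dist z y ≤ dist x y - s + δ := by
  have hlt : Manifold.riemannianEDist I x y < ENNReal.ofReal (dist x y + δ) := by
    rw [← IsRiemannianManifold.out (I := I) x y, edist_dist]
    exact (ENNReal.ofReal_lt_ofReal_iff (by positivity)).2 (by linarith)
  obtain ⟨γ, h0, h1, hγ, hlen⟩ := Manifold.exists_lt_of_riemannianEDist_lt hlt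
  have hcont : ContinuousOn (fun t => dist x (γ t)) (Icc 0 1) :=
    by
    have := hγ.continuousOn
    fun_prop
  -- Cut an almost shortest curve where its distance from `x` equals `s`; the lengths of the two
  -- pieces add up.
  obtain ⟨t, ht, hts⟩ := intermediate_value_Icc zero_le_one hcont (by
    simpa [h0, h1] using ⟨hs, hsy⟩ : s ∈ Icc (dist x (γ 0)) (dist x (γ 1)))
  have e1 := Manifold.riemannianEDist_le_pathELength
    (hγ.mono (Icc_subset_Icc_right ht.2)) h0 rfl ht.1
  have e2 := Manifold.riemannianEDist_le_pathELength
    (hγ.mono (Icc_subset_Icc_left ht.1)) rfl h1 ht.2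
  rw [← IsRiemannianManifold.out (I := I)] at e1 e2
  have hsum := (add_le_add e1 e2).trans_lt
    ((Manifold.pathELength_add ht.1 ht.2).trans_lt hlen)
  rw [edist_dist, edist_dist, ← ENNReal.ofReal_add dist_nonneg dist_nonneg,
    ENNReal.ofReal_lt_ofReal_iff (by positivity)] at hsum
  simp only at hts
  exact ⟨γ t, hts, by linarith⟩

/-- **Hopf--Rinow--Cohn-Vossen**: a complete locally compact length space is proper. -/
theorem ProperSpace.of_exists_dist_le_add {X : Type*} [PseudoMetricSpace X] [CompleteSpace X]
    [LocallyCompactSpace X]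
    (h : ∀ (x y : X) (s δ : ℝ), 0 ≤ s → s ≤ dist x y → 0 < δ →
      ∃ z, dist x z = s ∧ dist z y ≤ dist x y - s + δ) : ProperSpace X := by
  refine ⟨fun o r₁ => ?_⟩
  by_contra hr₁
  set S : Set ℝ := {r | IsCompact (closedBall o r)}
  have hmono : ∀ {r r'}, r ≤ r' → r' ∈ S → r ∈ S := fun hrr hr' =>
    IsCompact.of_isClosed_subset hr' isClosed_closedBall (closedBall_subset_closedBall hrr)
  have hbdd : BddAbove S := ⟨r₁, fun r hr => le_of_not_gt fun hlt => hr₁ (hmono hlt.le hr)⟩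
  obtain ⟨ρ, hρ, hρS⟩ : ∃ ρ > 0, ρ ∈ S := by
    obtain ⟨K, hK, hoK⟩ := exists_compact_mem_nhds o
    obtain ⟨ρ, hρ, hsub⟩ := nhds_basis_closedBall.mem_iff.1 hoK
    exact ⟨ρ, hρ, hK.of_isClosed_subset isClosed_closedBall hsub⟩
  set R := sSup S
  have hR : 0 < R := hρ.trans_le (le_csSup hbdd hρS)
  have hltR : ∀ r < R, r ∈ S := fun r hr => by
    obtain ⟨r', hr', hlt⟩ := exists_lt_of_lt_csSup ⟨ρ, hρS⟩ hr
    exact hmono hlt.le hr'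
  -- The supremum is attained: the ball of radius `R` lies close to a slightly smaller compact ball,
  -- hence is totally bounded.
  have hRS : R ∈ S := by
    refine isCompact_iff_totallyBounded_isComplete.2
      ⟨totallyBounded_iff.2 fun ε hε => ?_, isClosed_closedBall.isComplete⟩
    set r' := max 0 (R - ε / 3)
    have hr'S : r' ∈ S := hltR _ (max_lt hR (by linarith))
    obtain ⟨t, ht, hcov⟩ := totallyBounded_iff.1 hr'S.totallyBounded (ε / 3) (by positivity)
    have hr'R : R - ε / 3 ≤ r' := le_max_right _ _
    refine ⟨t, ht, fun y hy => ?_⟩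
    rw [mem_closedBall'] at hy
    obtain ⟨z, hz, hzy⟩ : ∃ z ∈ closedBall o r', dist y z ≤ 2 * ε / 3 := by
      rcases le_total (dist o y) r' with hle | hle
      · exact ⟨y, mem_closedBall'.2 hle, by rw [dist_self]; positivity⟩
      · obtain ⟨z, hz, hzy⟩ := h o y r' (ε / 3) (le_max_left _ _) hle (by positivity)
        exact ⟨z, mem_closedBall'.2 hz.le, by rw [dist_comm]; linarith⟩
    obtain ⟨c, hc, hzc⟩ := mem_iUnion₂.1 (hcov hz)
    refine mem_iUnion₂.2 ⟨c, hc, ?_⟩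
    rw [mem_ball] at hzc ⊢
    linarith [dist_triangle y z c]
  -- By local compactness a thickening of this ball is compact, and it contains a ball of radius
  -- beyond the supremum.
  obtain ⟨δ, hδ, hcomp⟩ := IsCompact.exists_isCompact_cthickening hRS
  have : R + δ / 2 ∈ S := by
    refine hcomp.of_isClosed_subset isClosed_closedBall fun y hy => ?_
    rw [mem_closedBall'] at hy
    rcases le_total (dist o y) R with hle | hle
    · exact self_subset_cthickening _ (mem_closedBall'.2 hle)
    · obtain ⟨z, hz, hzy⟩ := h o y R (δ / 2) hR.le hle (by positivity)
      refine mem_cthickening_of_dist_le y z δ _ (mem_closedBall'.2 hz.le) ?_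
      rw [dist_comm]
      linarith
  linarith [le_csSup hbdd this]

/-- In a proper length space, there are points at any prescribed distance from `x` on a shortest
path from `x` to `y`. -/
theorem exists_dist_eq_dist_eq_sub {X : Type*} [PseudoMetricSpace X] [ProperSpace X]
    (h : ∀ (x y : X) (s δ : ℝ), 0 ≤ s → s ≤ dist x y → 0 < δ →
      ∃ z, dist x z = s ∧ dist z y ≤ dist x y - s + δ) {x y : X} {s : ℝ} (hs : 0 ≤ s)
    (hsy : s ≤ dist x y) : ∃ z, dist x z = s ∧ dist z y = dist x y - s := by
  obtain ⟨z₁, hz₁, -⟩ := h x y s 1 hs hsy one_pos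
  obtain ⟨z, hz, hmin⟩ := (isCompact_sphere x s).exists_isMinOn ⟨z₁, mem_sphere'.2 hz₁⟩
    (f := fun z => dist z y) (by fun_prop)
  rw [mem_sphere'] at hz
  refine ⟨z, hz, le_antisymm (le_of_forall_pos_le_add fun δ hδ => ?_) ?_⟩
  · obtain ⟨w, hw, hwy⟩ := h x y s δ hs hsy hδ
    exact (hmin (mem_sphere'.2 hw)).trans hwy
  · linarith [dist_triangle x z y]

/-- A compact set has a finite separated net. -/
theorem IsCompact.exists_finset_separated_net {X : Type*} [PseudoMetricSpace X] {K : Set X}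
    (hK : IsCompact K) {ε : ℝ} (hε : 0 < ε) :
    ∃ N : Finset X, ↑N ⊆ K ∧ (∀ y ∈ N, ∀ y' ∈ N, y ≠ y' → ε < dist y y') ∧
      ∀ x ∈ K, ∃ y ∈ N, dist x y ≤ ε := by
  lift ε to NNReal using hε.le
  have hε' : ε ≠ 0 := by rintro rfl; simp at hε
  have htop : packingNumber ε K ≠ ⊤ := by
    obtain ⟨C, -, hC, hcov⟩ := exists_finite_isCover_of_isCompact (ε := ε / 2)
      (by positivity) hK
    have := packingNumber_two_mul_le_externalCoveringNumber (ε / 2) K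
    rw [mul_div_cancel₀ _ two_ne_zero] at this
    exact ne_top_of_le_ne_top hC.encard_lt_top.ne
      (this.trans hcov.externalCoveringNumber_le_encard)
  have hfin : (maximalSeparatedSet ε K).Finite := by
    rw [← encard_ne_top_iff, encard_maximalSeparatedSet htop]
    exact htop
  refine ⟨hfin.toFinset, by simpa using maximalSeparatedSet_subset, fun y hy y' hy' hne => ?_,
    fun x hx => ?_⟩
  · have := isSeparated_maximalSeparatedSet (hfin.mem_toFinset.1 hy) (hfin.mem_toFinset.1 hy') hne
    simp only [edist_nndist] at this
    exact_mod_cast this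
  · obtain ⟨y, hy, hxy⟩ := isCover_maximalSeparatedSet htop hx
    refine ⟨y, hfin.mem_toFinset.2 hy, ?_⟩
    simp only [mem_ofPred_eq, edist_nndist] at hxy
    exact_mod_cast hxy

/-! ### Void probabilities and survival of lines of descent. -/

theorem poissonLaw_singleton_zero_le {r : ℝ≥0∞} {b : ℝ} (hb : ENNReal.ofReal b ≤ r) :
    poissonLaw r {0} ≤ ENNReal.ofReal (Real.exp (-b)) := by
  unfold poissonLaw
  split_ifs with hr
  · simp
  · have hpre : (fun n : ℕ => (n : ℝ≥0∞)) ⁻¹' {0} = {0} := by ext n; simp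
    rw [Measure.map_apply (by fun_prop) (measurableSet_singleton _), hpre,
      poissonMeasure_singleton]
    refine ENNReal.ofReal_le_ofReal ?_
    have := ENNReal.ofReal_le_iff_le_toReal hr |>.1 hb
    simpa [ENNReal.coe_toNNReal_eq_toReal] using this

/-- The probability that a Poisson process has no point in any of finitely many disjoint sets, each
of intensity at least `log 2`, is at most `2⁻¹` to the number of sets. -/
theorem IsPoissonProcess.measure_biInter_eq_zero_le {Ω M ι : Type*} [MeasurableSpace Ω]
    [MetricSpace M] [MeasurableSpace M] {η : Ω → Measure M} {μ : Measure M} {P : Measure Ω}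
    (hη : IsPoissonProcess η μ P) (T : Finset ι) (A : ι → Set M)
    (hA : ∀ i ∈ T, MeasurableSet (A i)) (hdisj : (T : Set ι).PairwiseDisjoint A)
    (hμ : ∀ i ∈ T, ENNReal.ofReal (Real.log 2) ≤ μ (A i)) :
    P (⋂ i ∈ T, {ω | η ω (A i) = 0}) ≤ 2⁻¹ ^ T.card := by
  set e := T.equivFin
  have hind := hη.iIndepFun T.card (fun j => A (e.symm j)) (fun j => hA _ (e.symm j).2)
    (fun i j hij => hdisj (e.symm i).2 (e.symm j).2
      (fun h => hij (e.symm.injective (Subtype.ext h))))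
  have hprod := hind.measure_inter_preimage_eq_mul Finset.univ (sets := fun _ => {0})
    (fun _ _ => measurableSet_singleton _)
  have heq : (⋂ i ∈ T, {ω | η ω (A i) = 0}) =
      ⋂ j ∈ (Finset.univ : Finset (Fin T.card)),
        (fun ω => η ω (A (e.symm j))) ⁻¹' {0} := by
    ext ω
    simp only [mem_iInter, mem_ofPred_eq, Finset.mem_univ, true_imp_iff, mem_preimage,
      mem_singleton_iff]
    refine ⟨fun h j => h _ (e.symm j).2, fun h i hi => ?_⟩
    simpa using h (e ⟨i, hi⟩)
  rw [heq, hprod]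
  calc _ ≤ ∏ _j : Fin T.card, (2⁻¹ : ℝ≥0∞) := by
        refine Finset.prod_le_prod' fun j _ => ?_
        have hlaw := (hη.hasLaw _ (hA _ (e.symm j).2)).measure_eq (p := fun r => r = 0)
          (measurableSet_singleton _)
        refine (hlaw.trans_le (poissonLaw_singleton_zero_le (hμ _ (e.symm j).2))).trans_eq ?_
        rw [Real.exp_neg, Real.exp_log two_pos, ENNReal.ofReal_inv_of_pos two_pos]
        simp
    _ = _ := by simp

/-- `survivalEvent E child n z` is the event that there is a line of descent of `n` generations
starting at `z` such that, for each of its members but the last, the events `E w` occur for all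
children `w` of that member. -/
def survivalEvent {Ω ι : Type*} (E : ι → Set Ω) (child : ι → Finset ι) : ℕ → ι → Set Ω
  | 0, _ => univ
  | n + 1, z => (⋂ w ∈ child z, E w) ∩ ⋃ w ∈ child z, survivalEvent E child n w

/-- The set `T` makes the induction work: it collects the events imposed by earlier generations.
Since `ρ` increases strictly along descent, the children are new indices, and their factors multiply
with those of `T`. -/
theorem measure_biInter_inter_survivalEvent_le {Ω ι : Type*} [MeasurableSpace Ω] {P : Measure Ω}
    {E : ι → Set Ω} {child : ι → Finset ι} {ρ : ι → ℝ} {V : Set ι}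
    (hchild : ∀ z ∈ V, ∀ w ∈ child z, w ∈ V ∧ ρ z < ρ w ∧ ∀ w' ∈ child z, ρ w' ≤ ρ w)
    (hP : ∀ T : Finset ι, ↑T ⊆ V → P (⋂ i ∈ T, E i) ≤ 2⁻¹ ^ T.card)
    (n : ℕ) {z : ι} (hz : z ∈ V) (T : Finset ι) (hT : ↑T ⊆ V) (hTz : ∀ i ∈ T, ρ i ≤ ρ z) :
    P ((⋂ i ∈ T, E i) ∩ survivalEvent E child n z) ≤ 2⁻¹ ^ T.card * 2⁻¹ ^ n := by
  classical
  induction n generalizing z T with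
  | zero => simpa [survivalEvent] using hP T hT
  | succ n ih =>
    have hdisj : Disjoint T (child z) := Finset.disjoint_left.2 fun i hi hic =>
      (hTz i hi).not_gt (hchild z hz i hic).2.1
    have hsub : (⋂ i ∈ T, E i) ∩ survivalEvent E child (n + 1) z ⊆
        ⋃ w ∈ child z, ((⋂ i ∈ T ∪ child z, E i) ∩ survivalEvent E child n w) := by
      rintro ω ⟨hω, hωc, hωs⟩
      obtain ⟨w, hw, hωw⟩ := mem_iUnion₂.1 hωs
      refine mem_iUnion₂.2 ⟨w, hw, mem_iInter₂.2 fun i hi => ?_, hωw⟩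
      rcases Finset.mem_union.1 hi with hi | hi
      · exact mem_iInter₂.1 hω i hi
      · exact mem_iInter₂.1 hωc i hi
    have hnum : ((child z).card : ℝ≥0∞) * 2⁻¹ ^ (child z).card ≤ 2⁻¹ := by
      have h2 : 2 * (child z).card ≤ 2 ^ (child z).card := by
        generalize (child z).card = m
        rcases m with _ | m
        · simp
        · rw [pow_succ']
          exact Nat.mul_le_mul_left _ (Nat.lt_two_pow_self)
      rw [← ENNReal.inv_pow, ← div_eq_mul_inv]
      refine ENNReal.div_le_of_le_mul ?_
      rw [mul_comm, ← div_eq_mul_inv, ENNReal.le_div_iff_mul_le (by simp) (by simp), mul_comm]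
      exact_mod_cast h2
    calc _ ≤ ∑ w ∈ child z, P ((⋂ i ∈ T ∪ child z, E i) ∩ survivalEvent E child n w) :=
          (measure_mono hsub).trans (measure_biUnion_finset_le _ _)
      _ ≤ ∑ w ∈ child z, 2⁻¹ ^ (T ∪ child z).card * 2⁻¹ ^ n := by
          refine Finset.sum_le_sum fun w hw => ih (hchild z hz w hw).1 _ ?_ fun i hi => ?_
          · rw [Finset.coe_union]
            exact union_subset hT fun w hw => (hchild z hz w hw).1
          · rcases Finset.mem_union.1 hi with hi | hi
            · exact (hTz i hi).trans (hchild z hz w hw).2.1.le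
            · exact (hchild z hz w hw).2.2 i hi
      _ = 2⁻¹ ^ T.card * ((child z).card * 2⁻¹ ^ (child z).card) * 2⁻¹ ^ n := by
          rw [Finset.sum_const, nsmul_eq_mul, Finset.card_union_of_disjoint hdisj, pow_add]
          ring
      _ ≤ 2⁻¹ ^ T.card * 2⁻¹ * 2⁻¹ ^ n := by gcongr
      _ = _ := by rw [pow_succ]; ring

theorem IsPointConfiguration.exists_mem_pointSet {M : Type*} [MetricSpace M] [MeasurableSpace M]
    [BorelSpace M] {ν : Measure M} (hν : IsPointConfiguration ν) {B : Set M}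
    (hB : MeasurableSet B) (h : ν B ≠ 0) : ∃ q ∈ pointSet ν, q ∈ B := by
  obtain ⟨ι, _, p, rfl⟩ := hν.eq_sum_dirac
  obtain ⟨i, hi⟩ : ∃ i, p i ∈ B := by
    by_contra! hp
    exact h (by simp [Measure.sum_apply _ hB, hB, hp])
  refine ⟨p i, fun h0 => ?_, hi⟩
  rw [Measure.sum_apply _ (measurableSet_singleton _), ENNReal.tsum_eq_zero] at h0
  simpa using h0 i

/-! ### Large empty balls far from the origin. -/

/-- If all balls of radius `r₀` have measure at least `b₀`, then so have `m` times this measure the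
balls whose centre is at distance `2 * r₀ * i` from some point for each `i < m`. -/
theorem mul_le_measure_ball {M : Type*} [MetricSpace M] [MeasurableSpace M] [BorelSpace M]
    {μ : Measure M} {r₀ : ℝ} {b : ℝ≥0∞} (hr₀ : 0 < r₀) (hμ : ∀ x, b ≤ μ (ball x r₀))
    {y : M} {m : ℕ} (h : ∀ i < m, ∃ p, dist y p = 2 * r₀ * i) {ρ : ℝ} (hρ : 2 * r₀ * m ≤ ρ) :
    m * b ≤ μ (ball y ρ) := by
  have : Nonempty M := ⟨y⟩
  choose! p hp using h
  have hdisj : ((Finset.range m : Finset ℕ) : Set ℕ).PairwiseDisjoint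
      (fun i => ball (p i) r₀) := by
    intro i hi j hj hij
    wlog hlt : i < j generalizing i j
    · exact (this hj hi hij.symm (lt_of_le_of_ne (not_lt.1 hlt) hij.symm)).symm
    refine ball_disjoint_ball ?_
    have h1 := hp i (Finset.mem_range.1 hi)
    have h2 := hp j (Finset.mem_range.1 hj)
    have h3 : (i : ℝ) + 1 ≤ j := by exact_mod_cast hlt
    nlinarith [dist_triangle y (p i) (p j)]
  calc m * b = ∑ i ∈ Finset.range m, b := by simp
    _ ≤ ∑ i ∈ Finset.range m, μ (ball (p i) r₀) := Finset.sum_le_sum fun i _ => hμ _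
    _ = μ (⋃ i ∈ Finset.range m, ball (p i) r₀) :=
        (measure_biUnion_finset hdisj fun i _ => measurableSet_ball).symm
    _ ≤ μ (ball y ρ) := by
        refine measure_mono (iUnion₂_subset fun i hi => ball_subset_ball' ?_)
        have h1 := hp i (Finset.mem_range.1 hi)
        have h3 : (i : ℝ) + 1 ≤ m := by exact_mod_cast Finset.mem_range.1 hi
        rw [dist_comm, h1]
        nlinarith

/-- In a proper geodesic space, almost surely a Poisson process whose intensity measure is bounded
below on balls of a fixed radius meets all the balls `ball y (dist o y - 1)` with `y` far from
`o`. -/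
theorem IsPoissonProcess.measure_forall_exists_ball_eq_zero {Ω M : Type*} [MeasurableSpace Ω]
    [MetricSpace M] [ProperSpace M] [MeasurableSpace M] [BorelSpace M]
    (hM : ∀ (x y : M) (s : ℝ), 0 ≤ s → s ≤ dist x y → ∃ z, dist x z = s ∧ dist z y = dist x y - s)
    {η : Ω → Measure M} {μ : Measure M} {P : Measure Ω} (hη : IsPoissonProcess η μ P) {r₀ b₀ : ℝ}
    (hr₀ : 0 < r₀) (hb₀ : 0 < b₀) (hμ : ∀ x : M, ENNReal.ofReal b₀ ≤ μ (ball x r₀)) (o : M) :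
    P {ω | ∀ R, ∃ y, R ≤ dist o y ∧ η ω (ball y (dist o y - 1)) = 0} = 0 := by
  set m : ℕ := ⌈Real.log 2 / b₀⌉₊
  -- The second bound lets each small ball hold `m` disjoint `r₀`-balls, of total mass at least `log
  -- 2`; `4 ≤ a` absorbs the `- 1` in the radius of the large ball.
  obtain ⟨a, ha4, har⟩ : ∃ a : ℝ, 4 ≤ a ∧ 2 * r₀ * m ≤ a / 40 :=
    ⟨max 4 (40 * (2 * r₀ * m)), le_max_left _ _, by
      linarith [le_max_right 4 (40 * (2 * r₀ * m))]⟩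
  have ha : 0 < a := by linarith
  have hnet : ∀ r : ℝ, 0 < r → ∃ N : Finset M, ↑N ⊆ sphere o r ∧
      (∀ y ∈ N, ∀ y' ∈ N, y ≠ y' → r / 20 < dist y y') ∧
      ∀ x ∈ sphere o r, ∃ y ∈ N, dist x y ≤ r / 20 := fun r hr =>
    (isCompact_sphere o r).exists_finset_separated_net (by positivity)
  choose! N hNsub hNsep hNcov using hnet
  have hNdist : ∀ r, 0 < r → ∀ y ∈ N r, dist o y = r := fun r hr y hy =>
    mem_sphere'.1 (hNsub r hr hy)
  set V : Set M := {y | ∃ k : ℕ, y ∈ N (a * (3 / 2) ^ k)}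
  have hrad : ∀ k : ℕ, a ≤ a * (3 / 2) ^ k := fun k =>
    le_mul_of_one_le_right ha.le (one_le_pow₀ (by norm_num))
  have hVdist : ∀ y ∈ V, a ≤ dist o y := by
    rintro y ⟨k, hk⟩
    exact (hNdist _ (ha.trans_le (hrad k)) y hk).symm ▸ hrad k
  set A : M → Set M := fun y => ball y (dist o y / 40)
  set E : M → Set Ω := fun y => {ω | η ω (A y) = 0}
  set child : M → Finset M := fun z =>
    (N (3 / 2 * dist o z)).filter fun w => dist z w ≤ 5 / 8 * dist o z
  have hAdisj : V.PairwiseDisjoint A := by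
    rintro y ⟨k, hk⟩ y' ⟨k', hk'⟩ hne
    wlog hkk : k ≤ k' generalizing y y' k k'
    · exact (this k' hk' k hk hne.symm (le_of_not_ge hkk)).symm
    refine ball_disjoint_ball ?_
    have hd := hNdist _ (ha.trans_le (hrad k)) y hk
    have hd' := hNdist _ (ha.trans_le (hrad k')) y' hk'
    have hak := hrad k
    rcases hkk.eq_or_lt with rfl | hlt
    · have := hNsep _ (ha.trans_le hak) y hk y' hk' hne
      linarith
    · have hpow : a * (3 / 2) ^ k * (3 / 2) ≤ a * (3 / 2) ^ k' := by
        rw [mul_assoc, ← pow_succ]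
        gcongr
        · norm_num
        · exact hlt
      linarith [dist_triangle o y y']
  have hAμ : ∀ y ∈ V, ENNReal.ofReal (Real.log 2) ≤ μ (A y) := by
    intro y hy
    have hay := hVdist y hy
    have hle : ENNReal.ofReal (Real.log 2) ≤ m * ENNReal.ofReal b₀ := by
      rw [← ENNReal.ofReal_natCast, ← ENNReal.ofReal_mul (Nat.cast_nonneg _)]
      exact ENNReal.ofReal_le_ofReal ((div_le_iff₀ hb₀).1 (Nat.le_ceil _))
    refine hle.trans (mul_le_measure_ball hr₀ hμ (fun i hi => ?_) (by linarith))
    have him : (i : ℝ) ≤ m := by exact_mod_cast hi.le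
    obtain ⟨p, hp, -⟩ := hM y o (2 * r₀ * i) (by positivity) (by
      rw [dist_comm]
      nlinarith)
    exact ⟨p, hp⟩
  have hP : ∀ T : Finset M, ↑T ⊆ V → P (⋂ i ∈ T, E i) ≤ 2⁻¹ ^ T.card := fun T hT =>
    hη.measure_biInter_eq_zero_le T A (fun _ _ => measurableSet_ball) (hAdisj.subset hT)
      fun i hi => hAμ i (hT hi)
  have hchild : ∀ z ∈ V, ∀ w ∈ child z,
      w ∈ V ∧ dist o z < dist o w ∧ ∀ w' ∈ child z, dist o w' ≤ dist o w := by
    rintro z hz w hw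
    have haz := hVdist z hz
    have hd : ∀ w ∈ child z, dist o w = 3 / 2 * dist o z := fun w hw =>
      hNdist _ (by linarith) w (Finset.mem_filter.1 hw).1
    refine ⟨?_, by linarith [hd w hw], fun w' hw' => by rw [hd w hw, hd w' hw']⟩
    obtain ⟨k, hk⟩ := hz
    refine ⟨k + 1, ?_⟩
    have := (Finset.mem_filter.1 hw).1
    rw [hNdist _ (ha.trans_le (hrad k)) z hk] at this
    convert this using 2
    ring
  -- Here `p` runs along a geodesic from `o` to `y`, and `z` is a net point near `p`.
  have hsurv : ∀ (ω : Ω) (y : M), η ω (ball y (dist o y - 1)) = 0 → ∀ (n : ℕ) (p z : M),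
      a ≤ dist o p → z ∈ N (dist o p) → dist p z ≤ dist o p / 20 →
      dist p y ≤ dist o y - dist o p → dist o p * (3 / 2) ^ n ≤ dist o y →
      ω ∈ survivalEvent E child n z := by
    intro ω y hy n
    induction n with
    | zero => exact fun _ _ _ _ _ _ _ => mem_univ ω
    | succ n ih =>
      intro p z hap hz hpz hpy hn
      have hpn : dist o p * (3 / 2) ≤ dist o y := by
        refine le_trans ?_ hn
        rw [pow_succ']
        gcongr
        exact le_mul_of_one_le_right (by norm_num) (one_le_pow₀ (by norm_num))
      have hoz : dist o z = dist o p := hNdist _ (by linarith) z hz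
      obtain ⟨p', hp', hp'y⟩ := hM p y (dist o p / 2) (by positivity) (by
        linarith [dist_triangle o p y])
      have hop' : dist o p' = 3 / 2 * dist o p := by
        linarith [dist_triangle o p p', dist_triangle o p' y]
      obtain ⟨z', hz', hp'z'⟩ := hNcov (dist o p') (by linarith) p' (mem_sphere'.2 rfl)
      refine ⟨mem_iInter₂.2 fun w hw => ?_, mem_iUnion₂.2 ⟨z', ?_, ?_⟩⟩
      · have hw' := Finset.mem_filter.1 hw
        have how := hNdist _ (by linarith) w hw'.1
        -- In units of `dist o p`, `5/8 + 1/20 + 3/80 < 3/4`; the slack exceeds `a / 4 ≥ 1`.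
        refine measure_mono_null (ball_subset_ball' ?_) hy
        linarith [dist_triangle w z y, dist_triangle z p y, hw'.2, dist_comm w z, dist_comm z p]
      · refine Finset.mem_filter.2 ⟨by rwa [hoz, ← hop'], ?_⟩
        -- The 5/8 in `child` is `1/20 + 1/2 + 3/40`.
        linarith [dist_triangle z p z', dist_triangle p p' z', dist_comm z p]
      · refine ih p' z' (by linarith) hz' hp'z' (by linarith) ?_
        rw [hop']
        refine le_trans (le_of_eq ?_) hn
        ring
  have hbound : ∀ n : ℕ, P {ω | ∀ R, ∃ y, R ≤ dist o y ∧ η ω (ball y (dist o y - 1)) = 0} ≤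
      (N a).card * 2⁻¹ ^ n := by
    intro n
    have hsub : {ω | ∀ R, ∃ y, R ≤ dist o y ∧ η ω (ball y (dist o y - 1)) = 0} ⊆
        ⋃ z ∈ N a, survivalEvent E child n z := by
      intro ω hω
      obtain ⟨y, hyR, hy⟩ := hω (a * (3 / 2) ^ n)
      obtain ⟨p, hp, hpy⟩ := hM o y a ha.le ((hrad n).trans hyR)
      obtain ⟨z, hz, hpz⟩ := hNcov a ha p (mem_sphere'.2 hp)
      exact mem_iUnion₂.2 ⟨z, hz, hsurv ω y hy n p z hp.ge (by rwa [hp]) (by rwa [hp])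
        (by rw [hpy, hp]) (by rwa [hp])⟩
    calc _ ≤ ∑ z ∈ N a, P (survivalEvent E child n z) :=
          (measure_mono hsub).trans (measure_biUnion_finset_le _ _)
      _ ≤ ∑ z ∈ N a, 2⁻¹ ^ n := by
          refine Finset.sum_le_sum fun z hz => ?_
          have hzV : z ∈ V := ⟨0, by simpa using hz⟩
          simpa using measure_biInter_inter_survivalEvent_le hchild hP n hzV ∅ (by simp) (by simp)
      _ = _ := by simp
  have hlim : Filter.Tendsto (fun n : ℕ => ((N a).card : ℝ≥0∞) * 2⁻¹ ^ n) Filter.atTop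
      (nhds ((N a).card * 0)) :=
    ENNReal.Tendsto.const_mul
      (ENNReal.tendsto_pow_atTop_nhds_zero_of_lt_one (by simp)) (Or.inr (by simp))
  rw [mul_zero] at hlim
  exact le_antisymm (ge_of_tendsto' hlim hbound) zero_le

/-! ### Compactness of the cells. -/

/-- On a connected complete Riemannian manifold, if the intensity measure gives mass at least
`b₀ > 0` to every ball of radius `r₀ > 0`, then almost surely all Poisson--Voronoi cells are
compact. -/
theorem theoremB1 {d : ℕ} {M : Type*} [MetricSpace M] [ConnectedSpace M] [CompleteSpace M]
    [ChartedSpace (EuclideanSpace ℝ (Fin d)) M] [IsManifold (𝓡 d) ((⊤ : ℕ∞) : WithTop ℕ∞) M]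
    [Bundle.RiemannianBundle (fun x : M => TangentSpace (𝓡 d) x)]
    [IsContMDiffRiemannianBundle (𝓡 d) ((⊤ : ℕ∞) : WithTop ℕ∞) (EuclideanSpace ℝ (Fin d))
      (fun x : M => TangentSpace (𝓡 d) x)]
    [IsRiemannianManifold (𝓡 d) M]
    [MeasurableSpace M] [BorelSpace M]
    (μ : Measure M) (r₀ b₀ : ℝ) (hr₀ : 0 < r₀) (hb₀ : 0 < b₀)
    (hμ : ∀ x : M, ENNReal.ofReal b₀ ≤ μ (Metric.ball x r₀))
    {Ω : Type*} [MeasurableSpace Ω] (P : Measure Ω) [IsProbabilityMeasure P]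
    (η : Ω → Measure M) (hη : IsPoissonProcess η μ P) :
    ∀ᵐ ω ∂P, ∀ x ∈ pointSet (η ω), IsCompact (voronoiCell x (pointSet (η ω))) := by
  have : LocallyCompactSpace M := ChartedSpace.locallyCompactSpace (EuclideanSpace ℝ (Fin d)) M
  have : IsManifold (𝓡 d) 1 M :=
    IsManifold.of_le (n := ((⊤ : ℕ∞) : WithTop ℕ∞)) (by exact_mod_cast le_top)
  have hlen : ∀ (x y : M) (s δ : ℝ), 0 ≤ s → s ≤ dist x y → 0 < δ →
      ∃ z, dist x z = s ∧ dist z y ≤ dist x y - s + δ := fun x y s δ hs hsy hδ =>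
    IsRiemannianManifold.exists_dist_eq_dist_le_add (𝓡 d) hs hsy hδ
  have : ProperSpace M := ProperSpace.of_exists_dist_le_add hlen
  -- The nucleus `x` is random, so a single null set must serve all of them: countably many centres
  -- `o` suffice, one within distance 1 of each `x`.
  have hae : ∀ n, ∀ᵐ ω ∂P, ω ∉ {ω | ∀ R, ∃ y, R ≤ dist (TopologicalSpace.denseSeq M n) y ∧
      η ω (ball y (dist (TopologicalSpace.denseSeq M n) y - 1)) = 0} := fun n =>
    measure_eq_zero_iff_ae_notMem.1 (hη.measure_forall_exists_ball_eq_zero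
      (fun _ _ _ hs hsy => exists_dist_eq_dist_eq_sub hlen hs hsy) hr₀ hb₀ hμ _)
  filter_upwards [ae_all_iff.2 hae] with ω hω x _
  obtain ⟨n, hn⟩ := (TopologicalSpace.denseRange_denseSeq M).exists_mem_open isOpen_ball
    (nonempty_ball.2 one_pos : (ball x 1).Nonempty)
  replace hω := hω n
  generalize TopologicalSpace.denseSeq M n = o at hn hω
  simp only [not_forall, not_exists, not_and] at hω
  obtain ⟨R, hR⟩ := hω
  refine isCompact_of_isClosed_isBounded
    (isClosed_le (by fun_prop) Metric.continuous_infEDist)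
    (isBounded_closedBall.subset (t := closedBall o R) fun y hy => ?_)
  rw [mem_closedBall']
  by_contra! hlt
  obtain ⟨q, hq, hqy⟩ := (hη.isPointConfiguration ω).exists_mem_pointSet measurableSet_ball
    (hR y hlt.le)
  have hle : edist y x ≤ edist y q := le_trans hy (Metric.infEDist_le_edist_of_mem hq)
  rw [edist_dist, edist_dist, ENNReal.ofReal_le_ofReal_iff dist_nonneg] at hle
  rw [mem_ball'] at hqy
  rw [mem_ball] at hn
  linarith [dist_triangle o x y, dist_comm x y]
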